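/- Setting. Let $f:\mathbb R^n\to\mathbb R$, let $U\subseteq\mathbb R^n$ be open and convex, and let $f$ be Lipschitz continuous on $U$. Let $\partial f$ be the Clarke subdifferential of $f$ and assume that $f$ is path-differentiable along the segments of $U$: for all $x,y\in U$ and almost every $t\in[0,1]$, the function $s\mapsto f(x+s(y-x))$ is differentiable at $t$ with derivative $\langle v,y-x\rangle$ for every $v\in\partial f(x+t(y-x))$. Let $\bar x\in U$ be an isolated local minimizer of $f$ and the only point of $U$ with $0\in\partial f(x)$. Let $\partial_1 f(x)$, $x\in U$, be the projection of $0$ onto $\overline{\partial f(x)}$. Assume that $\partial_1 f$ is weakly uniformly Newton differentiable on $U$ with Newton differential $\mathcal Hf:U\rightrightarrows\mathbb R^{n\times n}$ and constant $c>0$, i.e. $\|\partial_1 f(x)-\partial_1 f(y)-H(x-y)\|\le c\|x-y\|$ for all $x,y\in U$, $H\in\mathcal Hf(x)$. Assume that all $H\in\mathcal Hf(x)$, $x\in U$, are symmetric positive definite, with $\|H\|\le\omega<\infty$ and $\|H^{-1}\|\le\Omega<\infty$ in the operator norm, and that $c\,\Omega<1$. (The graph of $\mathcal Hf$ over $U$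 is Borel.) Oracle. Let $\delta\in[0,1)$ and let $\mathbb H$ be a (jointly measurable) random function whose values at the points of $U$ are almost surely invertible $n\times n$ matrices, with $\mathbb P(\mathbb H(x)\in\mathcal Hf(x))\ge1-\delta$ for every $x\in U$. Algorithm. Given $x^0\in U$, $c_0>0$, $\alpha\in(0,1)$ and a tolerance $\varepsilon\ge 0$, put $X^0=x^0$ and, while $\|\partial_1 f(X^k)\|\ge\varepsilon$, sample $B^k$ such that, given the past, $(B^k)^{-1}$ is distributed as $\mathbb H(X^k)$, and put $Y^k=X^k-B^k\,\partial_1 f(X^k)$. If $f(X^k)-f(Y^k)\ge c_k\|Y^k-X^k\|^2$ and $c_k\|\partial_1 f(X^k)\|\le\|Y^k-X^k\|$, set $X^{k+1}=Y^k$, $c_{k+1}=c_k$; otherwise set $X^{k+1}=X^k$, $c_{k+1}=\alpha c_k$. Assume that almost surely all generated iterates $X^k$ lie in $U$, and so do the trial points $Y^k$ of those iterations for which $(B^k)^{-1}\in\mathcal Hf(X^k)$. Let $K_\varepsilon\in\mathbb N\cup\{\infty\}$ be the number of iterations before termination, i.e. the least $k$ with $\|\partial_1 f(X^k)\|<\varepsilon$,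 and $\infty$ if there is none. Theorem. 1. There exist $\rho_0>0$ and $\tau>0$, depending only on $f,U,\mathcal Hf$, such that for all $c_0>0$, $\alpha,\varepsilon\in(0,1)$, $\delta\in[0,1)$, $x^0\in U$ and every oracle and run as above, with $\rho=\min\{\rho_0,c_0\}$ and $$M=\frac{f(x^0)-f(\bar x)}{\rho(\tau\varepsilon)^2}+\frac{\log(\rho/c_0)}{\log\alpha},$$ one has $$\mathbb E(K_\varepsilon)\le\frac{1}{1-\delta}M .$$ If moreover $\delta\le\frac12$, then for every $\gamma\in(0,1)$ $$\mathbb P\left(K_\varepsilon\ge\frac{2+\gamma(1-\gamma^2)}{1-\gamma}\,\frac{1}{1-\delta}\,M\right)\le \exp\left(\frac{-\gamma^2}{1-\delta}\,M\right).$$ 2. For all $c_0>0$ and $\delta\in[0,1)$ there exist $\rho>0$ and $\tau>0$, depending only on $f,U,\mathcal Hf,c_0,\delta$, such that for all $\alpha\in(0,1)$, $\varepsilon\in[0,1)$, $x^0\in U\setminus\{\bar x\}$, every oracle and run as above, every $\gamma\in(0,1)$ and every fixed number of iterations $K\in\mathbb N$ with $(1-\gamma)K>\frac{\log(\rho/c_0)}{\log\alpha}$,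 $$\mathbb P\left(K\le K_\varepsilon\ \text{ and }\ \min_{0\le m\le K}\|\partial_1 f(X^m)\|\ge\sqrt{\frac{f(x^0)-f(\bar x)}{\rho\tau^2\left((1-\gamma)K-\frac{\log(\rho/c_0)}{\log\alpha}\right)}}\right)\le e^{-K(1-\delta)\gamma^2/2}.$$ For $\varepsilon=0$ the algorithm never stops, and the condition $K\le K_\varepsilon$ is void. -/

import Mathlib

universe u v

open MeasureTheory ProbabilityTheory Filter Topology
open scoped NNReal ENNReal

/-- `ℝⁿ` with the Euclidean norm. -/
abbrev EucSp (n : ℕ) : Type := EuclideanSpace ℝ (Fin n)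

/-- `ℝⁿˣⁿ`. -/
abbrev SqMat (n : ℕ) : Type := Matrix (Fin n) (Fin n) ℝ

/-- The Borel (equivalently, product) sigma-algebra on `ℝⁿˣⁿ`. -/
instance SqMat.instMeasurableSpace (n : ℕ) : MeasurableSpace (SqMat n) :=
  inferInstanceAs (MeasurableSpace (Fin n → Fin n → ℝ))

noncomputable section

/-- The action of a matrix on `ℝⁿ`. -/
def SqMat.act {n : ℕ} (H : SqMat n) (v : EucSp n) : EucSp n :=
  Matrix.toEuclideanCLM (n := Fin n) (𝕜 := ℝ) H v

/-- The operator norm of a matrix with respect to the Euclidean norm. -/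
def SqMat.opNorm {n : ℕ} (H : SqMat n) : ℝ :=
  ‖Matrix.toEuclideanCLM (n := Fin n) (𝕜 := ℝ) H‖

/-- Clarke's generalized directional derivative
`f°(x; d) = limsup_{y → x, t ↓ 0} (f (y + t d) - f y) / t`, with values in the extended reals. -/
def clarkeDirDeriv {n : ℕ} (f : EucSp n → ℝ) (x d : EucSp n) : EReal :=
  limsup (fun p : EucSp n × ℝ => (((f (p.1 + p.2 • d) - f p.1) / p.2 : ℝ) : EReal))
    (𝓝 x ×ˢ 𝓝[>] (0 : ℝ))

/-- The Clarke subdifferential `∂f(x) = {v | ∀ d, ⟨v, d⟩ ≤ f°(x; d)}`. -/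
def clarkeSubdiff {n : ℕ} (f : EucSp n → ℝ) (x : EucSp n) : Set (EucSp n) :=
  {v | ∀ d : EucSp n, ((inner ℝ v d : ℝ) : EReal) ≤ clarkeDirDeriv f x d}

/-- `G` is a single-valued adaptation of the set-valued map `S` on `U`: for every `x ∈ U`, `G x`
is a projection of `0` onto the closure of `S x`. -/
def IsSingleValuedAdaptation {n : ℕ} (S : EucSp n → Set (EucSp n)) (U : Set (EucSp n))
    (G : EucSp n → EucSp n) : Prop :=
  ∀ x ∈ U, G x ∈ closure (S x) ∧ ∀ v ∈ closure (S x), ‖G x‖ ≤ ‖v‖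

/-- `G` is weakly uniformly Newton differentiable on `U`, with Newton differential `HG` and with
the constant `c`. -/
def IsWeakNewtonDiff {n : ℕ} (G : EucSp n → EucSp n) (HG : EucSp n → Set (SqMat n))
    (U : Set (EucSp n)) (c : ℝ) : Prop :=
  ∀ x ∈ U, ∀ y ∈ U, ∀ H ∈ HG x, ‖G x - G y - H.act (x - y)‖ ≤ c * ‖x - y‖

/-- The Clarke subdifferential of `f` satisfies the chain rule along the segments of `U`
(path-differentiability along segments). -/
def IsPathDiff {n : ℕ} (f : EucSp n → ℝ) (U : Set (EucSp n)) : Prop :=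
  ∀ x ∈ U, ∀ y ∈ U, ∀ᵐ t ∂(volume.restrict (Set.Icc (0 : ℝ) 1)),
    ∀ v ∈ clarkeSubdiff f (x + t • (y - x)),
      HasDerivAt (fun s : ℝ => f (x + s • (y - x))) (inner ℝ v (y - x)) t

/-- The standing regularity assumption on the objective `f`; `G` is the single-valued adaptation
of the Clarke subdifferential of `f`, and `Hf` is the Newton differential of `G`. -/
structure RegularityAssumption {n : ℕ} (f : EucSp n → ℝ) (U : Set (EucSp n)) (xbar : EucSp n)
    (G : EucSp n → EucSp n) (Hf : EucSp n → Set (SqMat n)) : Prop where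
  isOpen : IsOpen U
  convex : Convex ℝ U
  mem : xbar ∈ U
  lipschitz : ∃ L : ℝ≥0, LipschitzOnWith L f U
  pathDiff : IsPathDiff f U
  localMin : IsLocalMin f xbar
  isolated : ∀ᶠ x in 𝓝[≠] xbar, ¬ IsLocalMin f x
  critical : ∀ x ∈ U, (0 : EucSp n) ∈ clarkeSubdiff f x ↔ x = xbar
  adaptation : IsSingleValuedAdaptation (clarkeSubdiff f) U G
  posDef : ∀ x ∈ U, ∀ H ∈ Hf x, H.PosDef
  bounded : ∃ ω : ℝ, ∀ x ∈ U, ∀ H ∈ Hf x, SqMat.opNorm H ≤ ω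
  newton : ∃ c > 0, ∃ Ω : ℝ, IsWeakNewtonDiff G Hf U c ∧
    (∀ x ∈ U, ∀ H ∈ Hf x, SqMat.opNorm H⁻¹ ≤ Ω) ∧ c * Ω < 1

/-- A random function `Hrand` with invertible values on `U`, defined on the probability space
`(Ξ, ν)`, that lies in the Newton differential `Hf` with probability at least `1 - δ` at every
point of `U`. -/
structure IsHessianOracle {n : ℕ} (U : Set (EucSp n)) (Hf : EucSp n → Set (SqMat n)) (δ : ℝ)
    {Ξ : Type*} [MeasurableSpace Ξ] (ν : Measure Ξ) (Hrand : EucSp n → Ξ → SqMat n) : Prop where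
  measurable : Measurable (Function.uncurry Hrand)
  det_ne_zero : ∀ x ∈ U, ∀ᵐ ξ ∂ν, (Hrand x ξ).det ≠ 0
  prob : ∀ x ∈ U, ENNReal.ofReal (1 - δ) ≤ ν {ξ | Hrand x ξ ∈ Hf x}

/-- The number of iterations before termination: the least `k` with `‖G (X k)‖ < ε`, and `⊤`
if there is none. Iteration `k` is executed if and only if `k < iterCount G ε X ω`. -/
def iterCount {n : ℕ} {Ω : Type*} (G : EucSp n → EucSp n) (ε : ℝ) (X : ℕ → Ω → EucSp n)
    (ω : Ω) : ℕ∞ :=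
  ⨅ (k : ℕ) (_ : ‖G (X k ω)‖ < ε), (k : ℕ∞)

/-- The trial point `x - B G(x)`, with `B = A⁻¹`. -/
def trialPoint {n : ℕ} (G : EucSp n → EucSp n) (A : SqMat n) (x : EucSp n) : EucSp n :=
  x - (A⁻¹).act (G x)

/-- The acceptance test for the trial point `y` at the iterate `x` with the parameter `c`. -/
def Accept {n : ℕ} (f : EucSp n → ℝ) (G : EucSp n → EucSp n) (c : ℝ) (x y : EucSp n) : Prop :=
  c * ‖y - x‖ ^ 2 ≤ f x - f y ∧ c * ‖G x‖ ≤ ‖y - x‖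

/-- `(X, A, C)` is a run of the backtracking stochastic Newton method with start `x₀`, initial
parameter `c₀`, backtracking factor `α` and tolerance `ε` on the filtered probability space
`(Ω, 𝓕, μ)`: `X k` are the iterates, `A k` is the sampled matrix, so that `B k = (A k)⁻¹`,
and `C k` is the acceptance parameter. Only iterations that are executed are constrained. -/
structure IsStochNewtonRun {n : ℕ} (f : EucSp n → ℝ) (U : Set (EucSp n))
    (G : EucSp n → EucSp n) (Hf : EucSp n → Set (SqMat n)) (x₀ : EucSp n) (c₀ α ε : ℝ)
    {Ξ : Type*} [MeasurableSpace Ξ] (ν : Measure Ξ) (Hrand : EucSp n → Ξ → SqMat n)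
    {Ω : Type*} {mΩ : MeasurableSpace Ω} (μ : Measure Ω) (𝓕 : Filtration ℕ mΩ)
    (X : ℕ → Ω → EucSp n) (A : ℕ → Ω → SqMat n) (C : ℕ → Ω → ℝ) : Prop where
  adapted : ∀ k : ℕ, Measurable[𝓕 k] (X k)
  sample_measurable : ∀ k : ℕ, Measurable[𝓕 (k + 1)] (A k)
  init : ∀ᵐ ω ∂μ, X 0 ω = x₀ ∧ C 0 ω = c₀
  /-- given the past, `A k` is distributed as `Hrand (X k)` -/
  sample_law : ∀ k : ℕ, ∀ S : Set (SqMat n), MeasurableSet S →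
    ∀ᵐ ω ∂μ, (k : ℕ∞) < iterCount G ε X ω →
      (μ⟦A k ⁻¹' S | 𝓕 k⟧) ω = ν.real {ξ | Hrand (X k ω) ξ ∈ S}
  success : ∀ k : ℕ, ∀ᵐ ω ∂μ, (k : ℕ∞) < iterCount G ε X ω →
    Accept f G (C k ω) (X k ω) (trialPoint G (A k ω) (X k ω)) →
      X (k + 1) ω = trialPoint G (A k ω) (X k ω) ∧ C (k + 1) ω = C k ω
  failure : ∀ k : ℕ, ∀ᵐ ω ∂μ, (k : ℕ∞) < iterCount G ε X ω →
    ¬ Accept f G (C k ω) (X k ω) (trialPoint G (A k ω) (X k ω)) →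
      X (k + 1) ω = X k ω ∧ C (k + 1) ω = α * C k ω
  /-- the iterates stay in `U` -/
  stays : ∀ k : ℕ, ∀ᵐ ω ∂μ, (k : ℕ∞) ≤ iterCount G ε X ω → X k ω ∈ U
  /-- the trial points of the true iterations stay in `U` -/
  stays_trial : ∀ k : ℕ, ∀ᵐ ω ∂μ, (k : ℕ∞) < iterCount G ε X ω → A k ω ∈ Hf (X k ω) →
    trialPoint G (A k ω) (X k ω) ∈ U

/-- `(f(x⁰) - f(x̄)) / (ρ (τ ε)²) + log (ρ / c₀) / log α`. -/
def iterBound {n : ℕ} (f : EucSp n → ℝ) (x₀ xbar : EucSp n) (ρ τ ε c₀ α : ℝ) : ℝ :=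
  (f x₀ - f xbar) / (ρ * (τ * ε) ^ 2) + Real.log (ρ / c₀) / Real.log α

end

/-! ### Matrices acting on Euclidean space -/

namespace SqMat

variable {n : ℕ}

/-! Call an iteration true if its sampled matrix lies in the Newton differential. Put `m = 1/Ω - c >
0`. Integrating the chain rule along the Newton segment shows that a step `d` from a true iteration
lowers `f` by at least `(m/2)‖d‖²`, while `‖d‖ ≥ ‖G x‖/ω`. Integrating along the segment to `xbar`
gives quadratic growth, hence `κ‖G x‖² ≤ f x - f xbar`. Both are in
`RegularityAssumption.exists_constants`.

Consequently a true iteration can be rejected only while the acceptance parameter exceeds `ρ`. Each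
rejection shrinks that parameter by `α`, so there are at most `L + 1` true rejections, where `L =
log(ρ/c₀)/log α`. Every true acceptance lowers `f` by a fixed multiple of the squared gradient
bound, and other iterations never raise `f`. This bounds the number of true iterations on each path
(`sum_indicator_true_le`).

Probability enters only through the fact that, given the past, an executed iteration is true with
probability at least `q = 1 - δ` (`IsStochNewtonRun.mul_measure_le`). Summing probabilities turns
the pathwise bound into the bound on the expectation (`lintegral_count_le`). An exponential
supermartingale gives a Chernoff bound for too few true iterations
(`measure_sum_indicator_le_chernoff`), from which both tail estimates follow. -/

lemma act_sub (H : SqMat n) (v w : EucSp n) : H.act (v - w) = H.act v - H.act w :=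
  map_sub _ v w

lemma act_neg (H : SqMat n) (v : EucSp n) : H.act (-v) = -H.act v :=
  map_neg _ v

lemma act_smul (H : SqMat n) (t : ℝ) (v : EucSp n) : H.act (t • v) = t • H.act v :=
  map_smul _ t v

lemma norm_act_le (H : SqMat n) (v : EucSp n) : ‖H.act v‖ ≤ H.opNorm * ‖v‖ :=
  ContinuousLinearMap.le_opNorm _ v

lemma act_act_inv {H : SqMat n} (hH : IsUnit H) (v : EucSp n) : H.act (H⁻¹.act v) = v := by
  have h : H * H⁻¹ = 1 := Matrix.mul_nonsing_inv _ ((Matrix.isUnit_iff_isUnit_det _).1 hH)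
  change (Matrix.toEuclideanCLM (n := Fin n) (𝕜 := ℝ) H *
    Matrix.toEuclideanCLM (n := Fin n) (𝕜 := ℝ) H⁻¹) v = v
  rw [← map_mul, h, map_one]
  rfl

lemma inner_act_comm {H : SqMat n} (hH : H.IsHermitian) (v w : EucSp n) :
    inner ℝ (H.act v) w = inner ℝ v (H.act w) := by
  rw [real_inner_comm]
  unfold act
  rw [Matrix.inner_toEuclideanCLM, Matrix.inner_toEuclideanCLM, Matrix.dotProduct_mulVec,
    ← Matrix.mulVec_transpose, dotProduct_comm]
  have : H.transpose = H := by simpa [Matrix.IsHermitian] using hH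
  rw [this]

lemma inner_act_nonneg {H : SqMat n} (hH : H.PosDef) (v : EucSp n) :
    0 ≤ inner ℝ (H.act v) v := by
  rw [real_inner_comm]
  unfold act
  rw [Matrix.inner_toEuclideanCLM]
  simpa using hH.posSemidef.dotProduct_mulVec_nonneg (v : Fin n → ℝ)

/-- A positive definite matrix whose inverse has norm at most `Ω` is bounded below by `1 / Ω`. -/
lemma norm_sq_div_le_inner_act {H : SqMat n} (hH : H.PosDef) {Ω : ℝ} (hΩ : 0 < Ω)
    (hinv : H⁻¹.opNorm ≤ Ω) (v : EucSp n) : ‖v‖ ^ 2 / Ω ≤ inner ℝ (H.act v) v := by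
  set b := H⁻¹.act v with hb
  have h1 : H.act b = v := act_act_inv hH.isUnit v
  have h2 : inner ℝ (H.act v) b = ‖v‖ ^ 2 := by
    rw [inner_act_comm hH.isHermitian, h1, real_inner_self_eq_norm_sq]
  have h3 : inner ℝ v b ≤ Ω * ‖v‖ ^ 2 := by
    calc inner ℝ v b ≤ ‖v‖ * ‖b‖ := real_inner_le_norm _ _
      _ ≤ ‖v‖ * (Ω * ‖v‖) := by
        gcongr
        exact (norm_act_le _ _).trans (by gcongr)
      _ = Ω * ‖v‖ ^ 2 := by ring
  -- Positivity of the quadratic form at this vector reads `⟨Hv,v⟩ - (2/Ω)‖v‖² + ⟨v,b⟩/Ω² ≥ 0`, and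
  -- `h3` bounds the last term by `‖v‖²/Ω`.
  have h4 := inner_act_nonneg hH (v - (1 / Ω) • b)
  rw [act_sub, act_smul, h1, inner_sub_left, inner_sub_right, inner_sub_right, inner_smul_left,
    inner_smul_right, inner_smul_right, inner_smul_left, h2, real_inner_self_eq_norm_sq] at h4
  simp only [conj_trivial] at h4
  have h5 : 1 / Ω * (1 / Ω * inner ℝ v b) ≤ 1 / Ω * (1 / Ω * (Ω * ‖v‖ ^ 2)) := by gcongr
  have h6 : 1 / Ω * (1 / Ω * (Ω * ‖v‖ ^ 2)) = 1 / Ω * ‖v‖ ^ 2 := by field_simp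
  have h7 : ‖v‖ ^ 2 / Ω = 1 / Ω * ‖v‖ ^ 2 := by ring
  linarith

end SqMat

/-! ### Consequences of the regularity assumption -/

/-- An intersection of closed half-spaces. So the projection onto the closure is itself a Clarke
subgradient, and the chain rule applies to `G`. -/
lemma isClosed_clarkeSubdiff {n : ℕ} (f : EucSp n → ℝ) (x : EucSp n) :
    IsClosed (clarkeSubdiff f x) := by
  simp only [clarkeSubdiff, Set.ofPred_forall]
  refine isClosed_iInter fun d => ?_
  exact isClosed_le (continuous_coe_real_ereal.comp (by fun_prop)) continuous_const

lemma IsSingleValuedAdaptation.mem_clarkeSubdiff {n : ℕ} {f : EucSp n → ℝ} {U : Set (EucSp n)}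
    {G : EucSp n → EucSp n} (h : IsSingleValuedAdaptation (clarkeSubdiff f) U G) {x : EucSp n}
    (hx : x ∈ U) : G x ∈ clarkeSubdiff f x :=
  (isClosed_clarkeSubdiff f x).closure_eq ▸ (h x hx).1

/-- A bound on the increment of a path-differentiable function along a segment. -/
lemma IsPathDiff.sub_le {n : ℕ} {f : EucSp n → ℝ} {U : Set (EucSp n)} (hU : Convex ℝ U)
    (hp : IsPathDiff f U) {L : ℝ≥0} (hL : LipschitzOnWith L f U) {g : EucSp n → EucSp n}
    (hg : ∀ z ∈ U, g z ∈ clarkeSubdiff f z) {x y : EucSp n} (hx : x ∈ U) (hy : y ∈ U) {a b : ℝ}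
    (h : ∀ t ∈ Set.Ioo (0 : ℝ) 1, x + t • (y - x) ∈ U →
      inner ℝ (g (x + t • (y - x))) (y - x) ≤ a + b * t) :
    f y - f x ≤ a + b / 2 := by
  have hmem : ∀ t ∈ Set.Icc (0 : ℝ) 1, x + t • (y - x) ∈ U := fun t ht =>
    hU.add_smul_sub_mem hx hy ht
  have hlip : LipschitzOnWith (L * ‖y - x‖₊) (fun s : ℝ => f (x + s • (y - x)))
      (Set.uIcc 0 1) := by
    rw [Set.uIcc_of_le zero_le_one]
    refine hL.comp (LipschitzWith.lipschitzOnWith ?_) hmem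
    refine LipschitzWith.of_dist_le_mul fun s t => ?_
    rw [dist_add_left, dist_eq_norm, ← sub_smul, norm_smul, dist_eq_norm, mul_comm]
    rfl
  -- Lipschitz continuity makes `f` along the segment the integral of its derivative, so an almost
  -- everywhere chain rule suffices.
  have hac := hlip.absolutelyContinuousOnInterval
  have hftc := hac.integral_deriv_eq_sub
  simp only [one_smul, add_sub_cancel, zero_smul, add_zero] at hftc
  have hint : ∫ t in (0 : ℝ)..1, (a + b * t) = a + b / 2 := by
    rw [intervalIntegral.integral_add (by simp) (Continuous.intervalIntegrable (by fun_prop) _ _),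
      intervalIntegral.integral_const, intervalIntegral.integral_const_mul, integral_id]
    norm_num
    ring
  rw [← hftc, ← hint]
  refine intervalIntegral.integral_mono_ae_restrict zero_le_one hac.intervalIntegrable_deriv
    (Continuous.intervalIntegrable (by fun_prop) _ _) ?_
  have h0 : ∀ᵐ t ∂(volume.restrict (Set.Icc (0 : ℝ) 1)), t ∈ Set.Ioo (0 : ℝ) 1 := by
    rw [← restrict_Ioo_eq_restrict_Icc]
    exact ae_restrict_mem measurableSet_Ioo
  filter_upwards [hp x hx y hy, h0] with t ht ht0
  have hm := hmem t ⟨ht0.1.le, ht0.2.le⟩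
  rw [(ht _ (hg _ hm)).deriv]
  exact h t ht0 hm

namespace RegularityAssumption

variable {n : ℕ} {f : EucSp n → ℝ} {U : Set (EucSp n)} {xbar : EucSp n}
  {G : EucSp n → EucSp n} {Hf : EucSp n → Set (SqMat n)}

lemma apply_xbar (h : RegularityAssumption f U xbar G Hf) : G xbar = 0 := by
  have h0 := (h.adaptation xbar h.mem).2 0 (subset_closure ((h.critical xbar h.mem).2 rfl))
  simpa using h0

/-- The quantitative consequences of the regularity assumption: sufficient decrease of the Newton
steps, and quadratic growth when all Newton differentials are nonempty. -/
lemma exists_constants (h : RegularityAssumption f U xbar G Hf) :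
    ∃ ρ > 0, ∃ τ > 0, ∃ κ > 0,
      (∀ x ∈ U, ∀ H ∈ Hf x, trialPoint G H x ∈ U →
        ρ * ‖trialPoint G H x - x‖ ^ 2 ≤ f x - f (trialPoint G H x) ∧
        ρ * ‖G x‖ ≤ ‖trialPoint G H x - x‖ ∧ τ * ‖G x‖ ≤ ‖trialPoint G H x - x‖) ∧
      ((∀ z ∈ U, (Hf z).Nonempty) →
        ContinuousOn G U ∧ ∀ x ∈ U, κ * ‖G x‖ ^ 2 ≤ f x - f xbar ∧
          (x ≠ xbar → 0 < f x - f xbar)) := by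
  obtain ⟨L, hL⟩ := h.lipschitz
  obtain ⟨ω₀, hω₀⟩ := h.bounded
  obtain ⟨c, hc, Ω₀, hN, hΩ₀, hcΩ₀⟩ := h.newton
  -- The given `Ω₀` need not be positive. Enlarging it to at least `1/(2c)` makes it so and keeps `c
  -- * Ω < 1`.
  set Ω := max Ω₀ (1 / (2 * c)) with hΩdef
  have hΩpos : 0 < Ω := lt_of_lt_of_le (by positivity) (le_max_right _ _)
  have hΩ : ∀ x ∈ U, ∀ H ∈ Hf x, SqMat.opNorm H⁻¹ ≤ Ω := fun x hx H hH =>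
    (hΩ₀ x hx H hH).trans (le_max_left _ _)
  have hcΩ : c * Ω < 1 := by
    rw [hΩdef, mul_max_of_nonneg _ _ hc.le]
    refine max_lt hcΩ₀ ?_
    field_simp
    norm_num
  set m := 1 / Ω - c with hm
  have hmpos : 0 < m := by
    rw [hm, sub_pos, lt_div_iff₀ hΩpos]
    exact hcΩ
  set ω := max ω₀ 1
  have hω1 : 1 ≤ ω := le_max_right _ _
  have hω : ∀ x ∈ U, ∀ H ∈ Hf x, SqMat.opNorm H ≤ ω := fun x hx H hH =>
    (hω₀ x hx H hH).trans (le_max_left _ _)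
  have hcoer : ∀ x ∈ U, ∀ H ∈ Hf x, ∀ v, 1 / Ω * ‖v‖ ^ 2 ≤ inner ℝ (H.act v) v := by
    intro x hx H hH v
    have := SqMat.norm_sq_div_le_inner_act (h.posDef x hx H hH) hΩpos (hΩ x hx H hH) v
    rwa [div_eq_inv_mul, ← one_div] at this
  have hlipG : ∀ x ∈ U, (Hf x).Nonempty → ∀ y ∈ U, ‖G x - G y‖ ≤ (ω + c) * ‖x - y‖ := by
    rintro x hx ⟨H, hH⟩ y hy
    have h1 := hN x hx y hy H hH
    have h2 : ‖H.act (x - y)‖ ≤ ω * ‖x - y‖ :=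
      (SqMat.norm_act_le _ _).trans (by gcongr; exact hω x hx H hH)
    have h3 := norm_add_le (G x - G y - H.act (x - y)) (H.act (x - y))
    rw [sub_add_cancel] at h3
    linarith
  have hgmem : ∀ z ∈ U, G z ∈ clarkeSubdiff f z := fun z hz => h.adaptation.mem_clarkeSubdiff hz
  refine ⟨min (m / 2) (1 / ω), by positivity, 1 / ω, by positivity, m / 2 / (ω + c) ^ 2,
    by positivity, ?_, ?_⟩
  · intro x hx H hH hy
    set y := trialPoint G H x with hydef
    have hyx : y - x = -(H⁻¹.act (G x)) := by
      rw [hydef, trialPoint]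
      abel
    have hHd : H.act (y - x) = -G x := by
      rw [hyx, SqMat.act_neg, SqMat.act_act_inv (h.posDef x hx H hH).isUnit]
    have hstep : 1 / ω * ‖G x‖ ≤ ‖y - x‖ := by
      have h1 : ‖G x‖ ≤ ω * ‖y - x‖ := by
        rw [← norm_neg, ← hHd]
        exact (SqMat.norm_act_le _ _).trans (by gcongr; exact hω x hx H hH)
      rw [one_div, inv_mul_le_iff₀ (by positivity)]
      exact h1
    refine ⟨?_, le_trans (by gcongr; exact min_le_right _ _) hstep, hstep⟩
    have hco := hcoer x hx H hH (y - x)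
    set q : ℝ := inner ℝ (H.act (y - x)) (y - x) with hq
    have hGx : inner ℝ (G x) (y - x) = -q := by
      rw [hq, hHd, inner_neg_left, neg_neg]
    -- With `d = y - x` and `H d = -G x`, the Newton estimate gives `⟨G (x + t d), d⟩ ≤ -(1 - t) q +
    -- t c‖d‖²`; its integral is `(-q + c‖d‖²)/2`, and coercivity bounds this by `-(m/2)‖d‖²`.
    have hdec := h.pathDiff.sub_le h.convex hL hgmem hx hy (a := -q)
      (b := q + c * ‖y - x‖ ^ 2) (by
        intro t ht hz
        have h1 := hN x hx _ hz H hH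
        set z := x + t • (y - x) with hzdef
        have h2 : x - z = -(t • (y - x)) := by rw [hzdef]; abel
        rw [h2, norm_neg, norm_smul, Real.norm_of_nonneg ht.1.le, SqMat.act_neg,
          SqMat.act_smul] at h1
        have h3 : G z = G x + t • H.act (y - x) -
          (G x - G z - -(t • H.act (y - x))) := by abel
        set e := G x - G z - -(t • H.act (y - x)) with he
        rw [h3, inner_sub_left, inner_add_left, inner_smul_left, hGx, ← hq]
        have h4 : -inner ℝ e (y - x) ≤ c * (t * ‖y - x‖) * ‖y - x‖ := by
          rw [← inner_neg_left]
          refine (real_inner_le_norm _ _).trans ?_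
          rw [norm_neg]
          gcongr
        simp only [conj_trivial]
        linarith)
    have h5 : min (m / 2) (1 / ω) * ‖y - x‖ ^ 2 ≤ m / 2 * ‖y - x‖ ^ 2 := by
      gcongr
      exact min_le_left _ _
    have h6 : m / 2 * ‖y - x‖ ^ 2 = (1 / Ω * ‖y - x‖ ^ 2 - c * ‖y - x‖ ^ 2) / 2 := by
      rw [hm]; ring
    linarith
  · intro hne
    have hlip : ∀ x ∈ U, ∀ y ∈ U, ‖G x - G y‖ ≤ (ω + c) * ‖x - y‖ := fun x hx =>
      hlipG x hx (hne x hx)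
    have hcont : ContinuousOn G U := by
      refine LipschitzOnWith.continuousOn (K := Real.toNNReal (ω + c))
        (LipschitzOnWith.of_dist_le_mul fun x hx y hy => ?_)
      rw [dist_eq_norm, dist_eq_norm, Real.coe_toNNReal _ (by positivity)]
      exact hlip x hx y hy
    have hgrow : ∀ x ∈ U, m / 2 * ‖x - xbar‖ ^ 2 ≤ f x - f xbar := by
      intro x hx
      -- Here the Newton differential is taken at the moving point `z` and compared with `xbar`,
      -- where `G` vanishes. This is why every `Hf z` has to be nonempty.
      have hdec := h.pathDiff.sub_le h.convex hL hgmem hx h.mem (a := -(m * ‖xbar - x‖ ^ 2))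
        (b := m * ‖xbar - x‖ ^ 2) (by
          intro t ht hz
          obtain ⟨H, hH⟩ := hne _ hz
          have h1 := hN _ hz xbar h.mem H hH
          have h2 := hcoer _ hz H hH (xbar - x)
          set z := x + t • (xbar - x) with hzdef
          have h3 : z - xbar = -((1 - t) • (xbar - x)) := by
            rw [hzdef, sub_smul, one_smul]; abel
          have ht1 : 0 < 1 - t := sub_pos.2 ht.2
          rw [h3, h.apply_xbar, norm_neg, norm_smul, Real.norm_of_nonneg ht1.le, SqMat.act_neg,
            SqMat.act_smul, sub_zero] at h1
          have h4 : G z = (G z - -((1 - t) • H.act (xbar - x))) -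
            (1 - t) • H.act (xbar - x) := by abel
          set e := G z - -((1 - t) • H.act (xbar - x)) with he
          rw [h4, inner_sub_left, inner_smul_left]
          have h5 : inner ℝ e (xbar - x) ≤ c * ((1 - t) * ‖xbar - x‖) * ‖xbar - x‖ := by
            refine (real_inner_le_norm _ _).trans ?_
            gcongr
          simp only [conj_trivial]
          have h6 := mul_le_mul_of_nonneg_left h2 ht1.le
          have h7 : -(m * ‖xbar - x‖ ^ 2) + m * ‖xbar - x‖ ^ 2 * t =
            c * ((1 - t) * ‖xbar - x‖) * ‖xbar - x‖ -
              (1 - t) * (1 / Ω * ‖xbar - x‖ ^ 2) := by rw [hm]; ring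
          linarith)
      rw [norm_sub_rev] at hdec
      linarith
    refine ⟨hcont, fun x hx => ⟨?_, fun hxx => ?_⟩⟩
    · refine le_trans ?_ (hgrow x hx)
      have h1 := hlip x hx xbar h.mem
      rw [h.apply_xbar, sub_zero] at h1
      rw [div_mul_eq_mul_div, div_le_iff₀ (by positivity)]
      calc m / 2 * ‖G x‖ ^ 2 ≤ m / 2 * ((ω + c) * ‖x - xbar‖) ^ 2 := by gcongr
        _ = _ := by ring
    · refine lt_of_lt_of_le ?_ (hgrow x hx)
      have : 0 < ‖x - xbar‖ := norm_pos_iff.2 (sub_ne_zero.2 hxx)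
      positivity

end RegularityAssumption

/-! ### Counting the true iterations along one run -/

lemma log_div_div_log_nonneg {ρ c₀ α : ℝ} (hρ : 0 < ρ) (hρc : ρ ≤ c₀) (hα : 0 < α)
    (hα1 : α < 1) : 0 ≤ Real.log (ρ / c₀) / Real.log α := by
  have hc : 0 < c₀ := hρ.trans_le hρc
  exact div_nonneg_of_nonpos (Real.log_nonpos (by positivity) ((div_le_one hc).2 hρc))
    (Real.log_neg hα hα1).le

lemma lt_log_div_log_of_lt_mul_pow {ρ c₀ α : ℝ} (hρ : 0 < ρ) (hc : 0 < c₀) (hα : 0 < α)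
    (hα1 : α < 1) {k : ℕ} (h : ρ < c₀ * α ^ k) :
    (k : ℝ) < Real.log (min ρ c₀ / c₀) / Real.log α := by
  have hle : ρ ≤ c₀ := h.le.trans (mul_le_of_le_one_right hc.le (pow_le_one₀ hα.le hα1.le))
  rw [min_eq_left hle, lt_div_iff_of_neg (Real.log_neg hα hα1), ← Real.log_pow]
  refine Real.log_lt_log (by positivity) ?_
  rw [div_lt_iff₀ hc]
  linarith

lemma accept_of_le {n : ℕ} {f : EucSp n → ℝ} {G : EucSp n → EucSp n} {c ρ : ℝ} {x y : EucSp n}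
    (hc : c ≤ ρ) (h1 : ρ * ‖y - x‖ ^ 2 ≤ f x - f y) (h2 : ρ * ‖G x‖ ≤ ‖y - x‖) :
    Accept f G c x y :=
  ⟨le_trans (by gcongr) h1, le_trans (by gcongr) h2⟩

/-- Along a run, all but boundedly many of the true iterations decrease the objective. -/
lemma sum_indicator_true_le {n : ℕ} {f : EucSp n → ℝ} {U : Set (EucSp n)} {xbar : EucSp n}
    {G : EucSp n → EucSp n} {Hf : EucSp n → Set (SqMat n)} {ρ τ κ c₀ α g : ℝ} {x₀ : EucSp n}
    (hρ : 0 < ρ) (hτ : 0 < τ) (hκ : 0 < κ) (hc₀ : 0 < c₀) (hα : 0 < α) (hα1 : α < 1) (hg : 0 ≤ g)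
    (hdec : ∀ x ∈ U, ∀ H ∈ Hf x, trialPoint G H x ∈ U →
      ρ * ‖trialPoint G H x - x‖ ^ 2 ≤ f x - f (trialPoint G H x) ∧
      ρ * ‖G x‖ ≤ ‖trialPoint G H x - x‖ ∧ τ * ‖G x‖ ≤ ‖trialPoint G H x - x‖)
    (hgrow : ∀ x ∈ U, κ * ‖G x‖ ^ 2 ≤ f x - f xbar)
    {x : ℕ → EucSp n} {A : ℕ → SqMat n} {c : ℕ → ℝ} {N : ℕ} (hx₀ : x 0 = x₀) (hc0 : c 0 = c₀)
    (hsucc : ∀ k < N, Accept f G (c k) (x k) (trialPoint G (A k) (x k)) →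
      x (k + 1) = trialPoint G (A k) (x k) ∧ c (k + 1) = c k)
    (hfail : ∀ k < N, ¬ Accept f G (c k) (x k) (trialPoint G (A k) (x k)) →
      x (k + 1) = x k ∧ c (k + 1) = α * c k)
    (hU : ∀ k ≤ N, x k ∈ U)
    (htrial : ∀ k < N, A k ∈ Hf (x k) → trialPoint G (A k) (x k) ∈ U)
    (hG : ∀ k < N, g ≤ ‖G (x k)‖) {s : Set ℕ} (hs : ∀ k < N, k ∈ s → A k ∈ Hf (x k)) :
    min κ (ρ * τ ^ 2) / 2 * (∑ k ∈ Finset.range N, s.indicator (fun _ => (1 : ℝ)) k -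
      Real.log (min ρ c₀ / c₀) / Real.log α) * g ^ 2 ≤ f x₀ - f xbar := by
  set L := Real.log (min ρ c₀ / c₀) / Real.log α
  have hL : 0 ≤ L := log_div_div_log_nonneg (lt_min hρ hc₀) (min_le_right _ _) hα hα1
  -- `F` counts all rejections, `S` the true acceptances and `T` the true rejections.
  have key : ∀ k ≤ N, ∃ F S T : ℕ,
      ∑ j ∈ Finset.range k, s.indicator (fun _ => (1 : ℝ)) j = S + T ∧ c k = c₀ * α ^ F ∧
      T ≤ F ∧ (T : ℝ) ≤ L + 1 ∧ f (x k) ≤ f x₀ - ρ * τ ^ 2 * g ^ 2 * S := by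
    intro k
    induction k with
    | zero => exact fun _ => ⟨0, 0, 0, by simp [hc0, hx₀, add_nonneg hL]⟩
    | succ k ih =>
      intro hk
      obtain ⟨F, S, T, h1, h2, h3, h4, h5⟩ := ih (by omega)
      have hkN : k < N := hk
      rw [Finset.sum_range_succ, h1]
      by_cases hacc : Accept f G (c k) (x k) (trialPoint G (A k) (x k))
      · obtain ⟨hx1, hc1⟩ := hsucc k hkN hacc
        rw [hx1, hc1]
        by_cases hks : k ∈ s
        · refine ⟨F, S + 1, T, ?_, h2, h3, h4, ?_⟩
          · simp [hks]
            ring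
          · obtain ⟨d1, -, d3⟩ := hdec _ (hU k hkN.le) _ (hs k hkN hks)
              (htrial k hkN (hs k hkN hks))
            have : ρ * (τ * g) ^ 2 ≤ ρ * ‖trialPoint G (A k) (x k) - x k‖ ^ 2 := by
              gcongr
              exact le_trans (by gcongr; exact hG k hkN) d3
            push_cast
            nlinarith
        · refine ⟨F, S, T, by simp [hks], h2, h3, h4, ?_⟩
          have h6 := hacc.1
          have : 0 ≤ c k * ‖trialPoint G (A k) (x k) - x k‖ ^ 2 := by
            rw [h2]
            positivity
          linarith
      · obtain ⟨hx1, hc1⟩ := hfail k hkN hacc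
        have hc2 : α * c k = c₀ * α ^ (F + 1) := by rw [h2]; ring
        rw [hx1, hc1]
        by_cases hks : k ∈ s
        · refine ⟨F + 1, S, T + 1, ?_, hc2, by omega, ?_, h5⟩
          · simp [hks]
            ring
          · obtain ⟨d1, d2, -⟩ := hdec _ (hU k hkN.le) _ (hs k hkN hks)
              (htrial k hkN (hs k hkN hks))
            -- A true trial point passes the test whenever the parameter is at most `ρ`, so a true
            -- rejection forces `F < L` beforehand.
            have h6 : ρ < c₀ * α ^ F := by
              rw [← h2]
              by_contra! h7
              exact hacc (accept_of_le h7 d1 d2)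
            have h7 := lt_log_div_log_of_lt_mul_pow hρ hc₀ hα hα1 h6
            have h8 : (T : ℝ) ≤ F := by exact_mod_cast h3
            push_cast
            change (F : ℝ) < L at h7
            linarith
        · exact ⟨F + 1, S, T, by simp [hks], hc2, by omega, h4, h5⟩
  obtain ⟨F, S, T, h1, -, -, h4, h5⟩ := key N le_rfl
  rw [h1]
  have hgN := hgrow _ (hU N le_rfl)
  have hD : ρ * τ ^ 2 * g ^ 2 * S ≤ f x₀ - f xbar := by
    have : 0 ≤ κ * ‖G (x N)‖ ^ 2 := by positivity
    linarith
  set m := min κ (ρ * τ ^ 2)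
  have hm : 0 < m := lt_min hκ (by positivity)
  have hm2 : m * g ^ 2 * S ≤ ρ * τ ^ 2 * g ^ 2 * S := by
    gcongr
    exact min_le_right _ _
  -- The case `N = 0` is separate because `m * g ^ 2 ≤ f x₀ - f xbar` below uses `g ≤ ‖G x₀‖`, known
  -- only if iteration 0 is executed.
  rcases Nat.eq_zero_or_pos N with rfl | hN
  · have h6 : (S : ℝ) + T = 0 := by simpa using h1.symm
    rw [h6]
    have : 0 ≤ ρ * τ ^ 2 * g ^ 2 * S := by positivity
    have h7 : 0 ≤ m / 2 * L * g ^ 2 := by positivity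
    linarith
  · have h6 : m * g ^ 2 ≤ f x₀ - f xbar := by
      have h7 := hgrow _ (hU 0 hN.le)
      rw [hx₀] at h7
      refine le_trans ?_ h7
      gcongr
      · exact min_le_left _ _
      · rw [← hx₀]
        exact hG 0 hN
    -- `T` may exceed `L` by one. The extra unit is paid for by the growth bound at `x₀`: both `m g²
    -- S` and `m g²` are at most `f x₀ - f xbar`, hence the factor `1/2` and the minimum with `κ`.
    have h7 : m / 2 * (S + T - L) * g ^ 2 ≤ m / 2 * (S + 1) * g ^ 2 := by
      gcongr
      linarith
    linarith

/-! ### Conditional laws and Chernoff bounds -/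

section ConditionalLaw

variable {Ω α β : Type*} {m mΩ : MeasurableSpace Ω} [MeasurableSpace α] [MeasurableSpace β]
  {μ : Measure Ω} [IsProbabilityMeasure μ]

/-- If the conditional law of `A` given `m ∋ σ(X)` is `κ (X ·)` on the event `E ∈ m`, then the joint
law of `(X, A)` on `E` is a composition product. -/
lemma map_prodMk_eq_compProd (hm : m ≤ mΩ) {X : Ω → α} (hX : Measurable[m] X) {A : Ω → β}
    (hA : Measurable A) (κ : Kernel α β) [IsMarkovKernel κ] {E : Set Ω} (hE : MeasurableSet[m] E)
    (hlaw : ∀ S : Set β, MeasurableSet S → ∀ᵐ ω ∂μ, ω ∈ E →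
      (μ⟦A ⁻¹' S | m⟧) ω = (κ (X ω)).real S) :
    (μ.restrict E).map (fun ω => (X ω, A ω)) = ((μ.restrict E).map X) ⊗ₘ κ := by
  have hX' : Measurable X := hX.mono hm le_rfl
  refine Measure.ext_prod fun {P S} hP hS => ?_
  rw [Measure.map_apply (hX'.prodMk hA) (hP.prod hS), Measure.compProd_apply_prod hP hS,
    setLIntegral_map hP (κ.measurable_coe hS) hX',
    Measure.restrict_restrict (hX' hP), Measure.restrict_apply ((hX'.prodMk hA) (hP.prod hS))]
  have hE' : MeasurableSet[m] (X ⁻¹' P ∩ E) := (hX hP).inter hE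
  have h1 : ∫ ω in X ⁻¹' P ∩ E, (μ⟦A ⁻¹' S | m⟧) ω ∂μ = μ.real (A ⁻¹' S ∩ (X ⁻¹' P ∩ E)) := by
    rw [setIntegral_condExp hm ((integrable_const (1 : ℝ)).indicator (hA hS)) hE',
      integral_indicator_const _ (hA hS)]
    simp [measureReal_restrict_apply (hA hS)]
  have h2 : ∫ ω in X ⁻¹' P ∩ E, (μ⟦A ⁻¹' S | m⟧) ω ∂μ =
      ∫ ω in X ⁻¹' P ∩ E, (κ (X ω)).real S ∂μ := by
    refine setIntegral_congr_ae (hm _ hE') ?_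
    filter_upwards [hlaw S hS] with ω hω hmem
    exact hω hmem.2
  have h3 : ∫ ω in X ⁻¹' P ∩ E, (κ (X ω)).real S ∂μ =
      (∫⁻ ω in X ⁻¹' P ∩ E, κ (X ω) S ∂μ).toReal := by
    refine integral_toReal ((κ.measurable_coe hS).comp hX').aemeasurable ?_
    exact ae_of_all _ fun ω => measure_lt_top _ _
  have h4 : ∫⁻ ω in X ⁻¹' P ∩ E, κ (X ω) S ∂μ ≠ ∞ := by
    refine ne_top_of_le_ne_top (measure_ne_top (μ.restrict (X ⁻¹' P ∩ E)) Set.univ) ?_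
    rw [← lintegral_one]
    exact lintegral_mono fun ω => prob_le_one
  have h5 : (fun ω => (X ω, A ω)) ⁻¹' P ×ˢ S ∩ E = A ⁻¹' S ∩ (X ⁻¹' P ∩ E) := by
    ext ω
    simp only [Set.mem_inter_iff, Set.mem_preimage, Set.mem_prod]
    tauto
  rw [h5, ← ENNReal.toReal_eq_toReal_iff' (measure_ne_top _ _) h4, ← h3, ← h2, h1]
  rfl

/-- The sampling law is given for fixed sets of matrices, but being true is a joint condition on
iterate and matrix. The joint law as a composition product allows sections that depend on `X`. -/
lemma mul_measure_le_measure_inter (hm : m ≤ mΩ) {X : Ω → α} (hX : Measurable[m] X) {A : Ω → β}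
    (hA : Measurable A) (κ : Kernel α β) [IsMarkovKernel κ] {E : Set Ω} (hE : MeasurableSet[m] E)
    (hlaw : ∀ S : Set β, MeasurableSet S → ∀ᵐ ω ∂μ, ω ∈ E →
      (μ⟦A ⁻¹' S | m⟧) ω = (κ (X ω)).real S) {B : Set (α × β)} (hB : MeasurableSet B) {q : ℝ≥0∞}
    (hq : ∀ ω ∈ E, q ≤ κ (X ω) (Prod.mk (X ω) ⁻¹' B)) :
    q * μ E ≤ μ (E ∩ {ω | (X ω, A ω) ∈ B}) := by
  have hX' : Measurable X := hX.mono hm le_rfl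
  have h1 : ((μ.restrict E).map (fun ω => (X ω, A ω))) B = μ (E ∩ {ω | (X ω, A ω) ∈ B}) := by
    rw [Measure.map_apply (hX'.prodMk hA) hB, Measure.restrict_apply ((hX'.prodMk hA) hB),
      Set.inter_comm]
    rfl
  rw [← h1, map_prodMk_eq_compProd hm hX hA κ hE hlaw, Measure.compProd_apply hB,
    lintegral_map (Kernel.measurable_kernel_prodMk_left hB) hX', ← setLIntegral_const]
  exact setLIntegral_mono' (hm _ hE) hq

end ConditionalLaw

/-- The laws of the values of a jointly measurable random function form a Markov kernel. -/
noncomputable def randomFunctionKernel {α β Ξ : Type*} [MeasurableSpace α] [MeasurableSpace β]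
    [MeasurableSpace Ξ] (ν : Measure Ξ) [IsProbabilityMeasure ν] (F : α → Ξ → β)
    (hF : Measurable (Function.uncurry F)) : Kernel α β where
  toFun x := ν.map (F x)
  measurable' := by
    refine Measure.measurable_of_measurable_coe _ fun S hS => ?_
    have : ∀ x, ν.map (F x) S = ν (Prod.mk x ⁻¹' (Function.uncurry F ⁻¹' S)) := fun x =>
      Measure.map_apply hF.of_uncurry_left hS
    simp_rw [this]
    exact measurable_measure_prodMk_left (hF hS)

lemma randomFunctionKernel_apply {α β Ξ : Type*} [MeasurableSpace α] [MeasurableSpace β]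
    [MeasurableSpace Ξ] (ν : Measure Ξ) [IsProbabilityMeasure ν] (F : α → Ξ → β)
    (hF : Measurable (Function.uncurry F)) (x : α) {S : Set β} (hS : MeasurableSet S) :
    randomFunctionKernel ν F hF x S = ν {ξ | F x ξ ∈ S} :=
  Measure.map_apply hF.of_uncurry_left hS

instance {α β Ξ : Type*} [MeasurableSpace α] [MeasurableSpace β]
    [MeasurableSpace Ξ] (ν : Measure Ξ) [IsProbabilityMeasure ν] (F : α → Ξ → β)
    (hF : Measurable (Function.uncurry F)) : IsMarkovKernel (randomFunctionKernel ν F hF) :=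
  ⟨fun _ => Measure.isProbabilityMeasure_map hF.of_uncurry_left.aemeasurable⟩

/-- Follows from `(1 + x + x²/2)(1 - x + x²/2) = 1 + x⁴/4 ≥ 1`. -/
lemma exp_neg_le_of_nonneg {x : ℝ} (hx : 0 ≤ x) : Real.exp (-x) ≤ 1 - x + x ^ 2 / 2 := by
  have h := Real.quadratic_le_exp_of_nonneg hx
  rw [Real.exp_neg]
  refine inv_le_of_inv_le₀ (by nlinarith [sq_nonneg (x - 1)]) (le_trans ?_ h)
  rw [inv_le_iff_one_le_mul₀ (by nlinarith [sq_nonneg (x - 1)])]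
  nlinarith [sq_nonneg (x ^ 2)]

/-- The hypothesis on `R` says that `S` has conditional probability at least `q` on `D`. It compares
two measures trimmed to `m`, so it passes from sets to nonnegative `m`-measurable functions. -/
lemma mul_lintegral_le_setLIntegral {Ω : Type*} {m mΩ : MeasurableSpace Ω} {μ : Measure Ω}
    (hm : m ≤ mΩ) {q : ℝ≥0∞}
    {D S : Set Ω} (hD : MeasurableSet[m] D)
    (h : ∀ R, MeasurableSet[m] R → R ⊆ D → q * μ R ≤ μ (R ∩ S)) {V : Ω → ℝ≥0∞}
    (hV : Measurable[m] V) (hVD : ∀ ω ∉ D, V ω = 0) :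
    q * ∫⁻ ω, V ω ∂μ ≤ ∫⁻ ω in S, V ω ∂μ := by
  have h1 : ∫⁻ ω, V ω ∂μ = ∫⁻ ω in D, V ω ∂μ := by
    rw [← lintegral_indicator (hm _ hD)]
    congr 1
    ext ω
    by_cases hω : ω ∈ D <;> simp [hω, hVD]
  rw [h1, ← lintegral_trim hm hV, ← lintegral_trim hm hV, ← smul_eq_mul,
    ← lintegral_smul_measure]
  refine lintegral_mono' ?_ le_rfl
  refine Measure.le_iff.2 fun R hR => ?_
  rw [Measure.smul_apply, trim_measurableSet_eq hm hR, trim_measurableSet_eq hm hR,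
    Measure.restrict_apply (hm _ hR), Measure.restrict_apply (hm _ hR), smul_eq_mul]
  refine (h _ (hR.inter hD) Set.inter_subset_right).trans (measure_mono ?_)
  exact Set.inter_subset_inter_left _ Set.inter_subset_left

section Chernoff

variable {Ω : Type*} {mΩ : MeasurableSpace Ω} {μ : Measure Ω} [IsProbabilityMeasure μ]

/-- The exponential weight of the number of events `T j`, `j < N`, on the intersection of the
events `E j`, `j < N`. -/
noncomputable def expWeight (E T : ℕ → Set Ω) (l : ℝ) (N : ℕ) (ω : Ω) : ℝ≥0∞ :=
  ∏ j ∈ Finset.range N, (E j).indicator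
    (fun ω => ENNReal.ofReal (Real.exp (-(l * (T j).indicator (fun _ => (1 : ℝ)) ω)))) ω

variable {E T : ℕ → Set Ω} {l : ℝ} {N : ℕ}

lemma expWeight_le_one (hl : 0 ≤ l) (ω : Ω) : expWeight E T l N ω ≤ 1 := by
  refine Finset.prod_le_one' fun j _ => ?_
  refine Set.indicator_le (s := E j) (g := fun _ => 1) (fun ω _ => ?_) ω |>.trans le_rfl
  rw [ENNReal.ofReal_le_one, Real.exp_le_one_iff, neg_nonpos]
  exact mul_nonneg hl (Set.indicator_nonneg (fun _ _ => zero_le_one) _)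

lemma measurable_expWeight {𝓕 : Filtration ℕ mΩ} (hE : ∀ k, MeasurableSet[𝓕 k] (E k))
    (hT : ∀ k, MeasurableSet[𝓕 (k + 1)] (T k)) : Measurable[𝓕 N] (expWeight E T l N) := by
  unfold expWeight
  refine Finset.measurable_fun_prod _ fun j hj => ?_
  have hjN : j < N := Finset.mem_range.1 hj
  have h1 : MeasurableSet[𝓕 N] (E j) := 𝓕.mono hjN.le _ (hE j)
  have h2 : MeasurableSet[𝓕 N] (T j) := 𝓕.mono hjN _ (hT j)
  refine Measurable.indicator ?_ h1
  exact (Real.measurable_exp.comp ((measurable_const.indicator h2).const_mul l).neg).ennreal_ofReal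

/-- One step of the supermartingale: if `a` and `b` are the integrals of the past weight over `T N`
and its complement, within `E N`, then `a ≥ q(a + b)`, so `e⁻ˡ a + b ≤ (1 - q(1 - e⁻ˡ))(a + b)`. -/
lemma lintegral_expWeight_le {𝓕 : Filtration ℕ mΩ} {q : ℝ} (hq : 0 ≤ q) (hq1 : q ≤ 1)
    (hl : 0 ≤ l) (hE : ∀ k, MeasurableSet[𝓕 k] (E k)) (hT : ∀ k, MeasurableSet[𝓕 (k + 1)] (T k))
    (h : ∀ k R, MeasurableSet[𝓕 k] R → R ⊆ E k → ENNReal.ofReal q * μ R ≤ μ (R ∩ T k)) :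
    ∫⁻ ω, expWeight E T l N ω ∂μ ≤ ENNReal.ofReal ((1 - q * (1 - Real.exp (-l))) ^ N) := by
  induction N with
  | zero => simp [expWeight]
  | succ N ih =>
    have hs0 : 0 < Real.exp (-l) := Real.exp_pos _
    have hs1 : Real.exp (-l) ≤ 1 := Real.exp_le_one_iff.2 (by linarith)
    set s := Real.exp (-l) with hs
    have hr : 0 ≤ 1 - q * (1 - s) := by nlinarith
    have hTm : MeasurableSet (T N) := 𝓕.le _ _ (hT N)
    set V : Ω → ℝ≥0∞ := (E N).indicator (expWeight E T l N) with hVdef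
    have hV : Measurable[𝓕 N] V := (measurable_expWeight hE hT).indicator (hE N)
    have hV' : Measurable V := hV.mono (𝓕.le _) le_rfl
    have hV1 : ∀ ω, V ω ≤ expWeight E T l N ω := fun ω => Set.indicator_le_self _ _ _
    have hprod : ∀ ω, expWeight E T l (N + 1) ω =
        V ω * ENNReal.ofReal (Real.exp (-(l * (T N).indicator (fun _ => (1 : ℝ)) ω))) := by
      intro ω
      rw [expWeight, Finset.prod_range_succ, hVdef]
      by_cases hω : ω ∈ E N <;> simp [hω, expWeight]
    have ha : ∫⁻ ω in T N, expWeight E T l (N + 1) ω ∂μ =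
        ENNReal.ofReal s * ∫⁻ ω in T N, V ω ∂μ := by
      rw [← lintegral_const_mul _ hV']
      refine setLIntegral_congr_fun hTm fun ω hω => ?_
      simp only [hprod, Set.indicator_of_mem hω, mul_one, mul_comm (V ω), hs]
    have hb : ∫⁻ ω in (T N)ᶜ, expWeight E T l (N + 1) ω ∂μ = ∫⁻ ω in (T N)ᶜ, V ω ∂μ := by
      refine setLIntegral_congr_fun hTm.compl fun ω hω => ?_
      simp only [hprod, Set.indicator_of_notMem hω]
      simp
    have hab := lintegral_add_compl (μ := μ) V hTm
    have hqa := mul_lintegral_le_setLIntegral (𝓕.le N) (hE N) (h N) hV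
      (fun ω hω => Set.indicator_of_notMem hω _)
    have hfin : ∫⁻ ω, V ω ∂μ ≠ ∞ := by
      refine ne_top_of_le_ne_top (measure_ne_top μ Set.univ) ?_
      rw [← lintegral_one]
      exact lintegral_mono fun ω => (hV1 ω).trans (expWeight_le_one hl ω)
    rw [← lintegral_add_compl _ hTm, ha, hb]
    have hle : ∫⁻ ω, V ω ∂μ ≤ ENNReal.ofReal ((1 - q * (1 - s)) ^ N) :=
      (lintegral_mono hV1).trans ih
    rw [← hab] at hqa hfin hle
    set a := ∫⁻ ω in T N, V ω ∂μ
    set b := ∫⁻ ω in (T N)ᶜ, V ω ∂μ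
    obtain ⟨hafin, hbfin⟩ := ENNReal.add_ne_top.1 hfin
    lift a to ℝ≥0 using hafin with a'
    lift b to ℝ≥0 using hbfin with b'
    have e1 : ((a' : ℝ≥0∞)) = ENNReal.ofReal a' := (ENNReal.ofReal_coe_nnreal).symm
    have e2 : ((b' : ℝ≥0∞)) = ENNReal.ofReal b' := (ENNReal.ofReal_coe_nnreal).symm
    have ha0 := a'.coe_nonneg
    have hb0 := b'.coe_nonneg
    rw [e1, e2, ← ENNReal.ofReal_add ha0 hb0, ENNReal.ofReal_le_ofReal_iff (by positivity)] at hle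
    rw [e1, e2, ← ENNReal.ofReal_add ha0 hb0, ← ENNReal.ofReal_mul hq,
      ENNReal.ofReal_le_ofReal_iff ha0] at hqa
    rw [e1, e2, ← ENNReal.ofReal_mul hs0.le, ← ENNReal.ofReal_add (by positivity) hb0]
    refine ENNReal.ofReal_le_ofReal ?_
    calc s * a' + b' ≤ (1 - q * (1 - s)) * (a' + b') := by
          nlinarith [mul_le_mul_of_nonneg_left hqa (sub_nonneg.2 hs1)]
      _ ≤ (1 - q * (1 - s)) * (1 - q * (1 - s)) ^ N := by gcongr
      _ = _ := by ring

/-- Chernoff's bound for the lower tail of the number of events `T j`, `j < N`, on the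
intersection of the events `E j`, `j < N`. -/
lemma measure_sum_indicator_le_chernoff {𝓕 : Filtration ℕ mΩ} {q : ℝ} (hq : 0 ≤ q) (hq1 : q ≤ 1)
    (hE : ∀ k, MeasurableSet[𝓕 k] (E k)) (hT : ∀ k, MeasurableSet[𝓕 (k + 1)] (T k))
    (h : ∀ k R, MeasurableSet[𝓕 k] R → R ⊆ E k → ENNReal.ofReal q * μ R ≤ μ (R ∩ T k))
    {η R : ℝ} (hη : 0 ≤ η) (hR : R ≤ (1 - η) * q * N) :
    μ {ω | (∀ j < N, ω ∈ E j) ∧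
        ∑ j ∈ Finset.range N, (T j).indicator (fun _ => (1 : ℝ)) ω ≤ R} ≤
      ENNReal.ofReal (Real.exp (-(η ^ 2 * q * N / 2))) := by
  -- The rate `l = η` is not optimal, but with `e^{-η} ≤ 1 - η + η²/2` it already yields the
  -- exponent `-η² q N / 2`.
  have hW := lintegral_expWeight_le (N := N) hq hq1 hη hE hT h
  have hWm : Measurable (expWeight E T η N) :=
    (measurable_expWeight (N := N) hE hT).mono (𝓕.le _) le_rfl
  have hsub : {ω | (∀ j < N, ω ∈ E j) ∧
      ∑ j ∈ Finset.range N, (T j).indicator (fun _ => (1 : ℝ)) ω ≤ R} ⊆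
      {ω | ENNReal.ofReal (Real.exp (-(η * R))) ≤ expWeight E T η N ω} := by
    rintro ω ⟨h1, h2⟩
    have : expWeight E T η N ω = ENNReal.ofReal (Real.exp
        (-(η * ∑ j ∈ Finset.range N, (T j).indicator (fun _ => (1 : ℝ)) ω))) := by
      rw [Finset.mul_sum, ← Finset.sum_neg_distrib, Real.exp_sum,
        ENNReal.ofReal_prod_of_nonneg fun j _ => (Real.exp_pos _).le]
      exact Finset.prod_congr rfl fun j hj =>
        Set.indicator_of_mem (h1 j (Finset.mem_range.1 hj)) _
    rw [Set.mem_ofPred_eq, this]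
    gcongr
  have hmarkov := (mul_meas_ge_le_lintegral (μ := μ) hWm
    (ENNReal.ofReal (Real.exp (-(η * R))))).trans hW
  have hs1 : Real.exp (-η) ≤ 1 := Real.exp_le_one_iff.2 (by linarith)
  have hpow : (1 - q * (1 - Real.exp (-η))) ^ N ≤
      Real.exp (-(q * (1 - Real.exp (-η)) * N)) := by
    have h1 : 1 - q * (1 - Real.exp (-η)) ≤ Real.exp (-(q * (1 - Real.exp (-η)))) := by
      have := Real.add_one_le_exp (-(q * (1 - Real.exp (-η))))
      linarith
    have h0 : 0 ≤ 1 - q * (1 - Real.exp (-η)) := by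
      nlinarith [Real.exp_pos (-η)]
    refine (pow_le_pow_left₀ h0 h1 N).trans_eq ?_
    rw [← Real.exp_nat_mul]
    ring_nf
  have hexp : Real.exp (-(q * (1 - Real.exp (-η)) * N)) ≤
      Real.exp (-(η * R)) * Real.exp (-(η ^ 2 * q * N / 2)) := by
    rw [← Real.exp_add, Real.exp_le_exp]
    have h1 := exp_neg_le_of_nonneg hη
    have h2 : q * N * (η - η ^ 2 / 2) ≤ q * N * (1 - Real.exp (-η)) :=
      mul_le_mul_of_nonneg_left (by linarith) (by positivity)
    have h3 := mul_le_mul_of_nonneg_left hR hη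
    linarith
  have hfinal : ENNReal.ofReal (Real.exp (-(η * R))) *
      μ {ω | ENNReal.ofReal (Real.exp (-(η * R))) ≤ expWeight E T η N ω} ≤
      ENNReal.ofReal (Real.exp (-(η * R))) *
        ENNReal.ofReal (Real.exp (-(η ^ 2 * q * N / 2))) := by
    rw [← ENNReal.ofReal_mul (Real.exp_pos _).le]
    exact hmarkov.trans (ENNReal.ofReal_le_ofReal (hpow.trans hexp))
  rw [ENNReal.mul_le_mul_iff_right (by simpa using Real.exp_pos _) ENNReal.ofReal_ne_top]
    at hfinal
  exact (measure_mono hsub).trans hfinal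

end Chernoff

/-! ### Expectation and tail of the iteration count -/

section Counting

variable {Ω : Type*} {mΩ : MeasurableSpace Ω} {μ : Measure Ω} {E T : ℕ → Set Ω} {K : Ω → ℕ∞}
  {M q : ℝ}

lemma ENat.toENNReal_le_of_forall_natCast_le {K : ℕ∞} {S : ℝ≥0∞}
    (h : ∀ N : ℕ, (N : ℕ∞) ≤ K → (N : ℝ≥0∞) ≤ S) : (K : ℝ≥0∞) ≤ S := by
  induction K with
  | top =>
    have : S = ∞ := ENNReal.eq_top_of_forall_nnreal_le fun r => by
      obtain ⟨N, hN⟩ := exists_nat_ge r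
      exact le_trans (by exact_mod_cast hN) (h N le_top)
    simp [this]
  | coe N => simpa using h N le_rfl

/-- If the events `T k` occur with conditional probability at least `q` as long as `k < K`, and at
most `M` of them occur before `K`, then the expectation of `K` is at most `M / q`. -/
lemma lintegral_count_le (hq : 0 < q) (hE : ∀ k, MeasurableSet (E k))
    (hT : ∀ k, MeasurableSet (T k))
    (h : ∀ k, ENNReal.ofReal q * μ (E k) ≤ μ (E k ∩ T k))
    (hK : ∀ᵐ ω ∂μ, ∀ N : ℕ, (N : ℕ∞) ≤ K ω ↔ ∀ j < N, ω ∈ E j)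
    (hanti : ∀ ω k, ω ∈ E k → ∀ j ≤ k, ω ∈ E j)
    (hM : ∀ᵐ ω ∂μ, ∀ N : ℕ, (N : ℕ∞) ≤ K ω →
      ∑ j ∈ Finset.range N, (T j).indicator (fun _ => (1 : ℝ)) ω ≤ M) [IsProbabilityMeasure μ] :
    ∫⁻ ω, (K ω : ℝ≥0∞) ∂μ ≤ ENNReal.ofReal (1 / q * M) := by
  have h1 : ∫⁻ ω, (K ω : ℝ≥0∞) ∂μ ≤ ∑' k, μ (E k) := by
    have : ∑' k, μ (E k) = ∫⁻ ω, ∑' k, (E k).indicator (fun _ => (1 : ℝ≥0∞)) ω ∂μ := by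
      rw [lintegral_tsum fun k => (measurable_const.indicator (hE k)).aemeasurable]
      simp [lintegral_indicator_const (hE _)]
    rw [this]
    refine lintegral_mono_ae ?_
    filter_upwards [hK] with ω hω
    refine ENat.toENNReal_le_of_forall_natCast_le fun N hN => ?_
    have hsum : ∑ k ∈ Finset.range N, (E k).indicator (fun _ => (1 : ℝ≥0∞)) ω = N := by
      rw [Finset.sum_congr rfl fun k hk =>
        Set.indicator_of_mem ((hω N).1 hN k (Finset.mem_range.1 hk)) _]
      simp
    rw [← hsum]
    exact ENNReal.sum_le_tsum _
  have h2 : ∑' k, μ (E k ∩ T k) ≤ ENNReal.ofReal M := by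
    have : ∑' k, μ (E k ∩ T k) =
        ∫⁻ ω, ∑' k, (E k ∩ T k).indicator (fun _ => (1 : ℝ≥0∞)) ω ∂μ := by
      rw [lintegral_tsum fun k =>
        (measurable_const.indicator ((hE k).inter (hT k))).aemeasurable]
      simp [lintegral_indicator_const ((hE _).inter (hT _))]
    rw [this]
    have hle : ∀ᵐ ω ∂μ, ∑' k, (E k ∩ T k).indicator (fun _ => (1 : ℝ≥0∞)) ω ≤
        ENNReal.ofReal M := by
      filter_upwards [hK, hM] with ω hω hMω
      rw [ENNReal.tsum_eq_iSup_nat]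
      refine iSup_le fun N => ?_
      induction N with
      | zero => simp
      | succ N ih =>
        -- On `E N` all earlier events hold, so `N + 1 ≤ K` and the bound `M` applies; off `E N` the
        -- new term vanishes.
        by_cases hN : ω ∈ E N
        · have h3 := hMω (N + 1) ((hω (N + 1)).2 fun j hj => hanti ω N hN j (by omega))
          refine le_trans ?_ (ENNReal.ofReal_le_ofReal h3)
          rw [ENNReal.ofReal_sum_of_nonneg fun j _ =>
            Set.indicator_nonneg (fun _ _ => zero_le_one) _]
          refine Finset.sum_le_sum fun j _ => ?_
          by_cases hj : ω ∈ T j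
          · rw [Set.indicator_of_mem hj, ENNReal.ofReal_one]
            exact Set.indicator_le (s := E j ∩ T j) (g := fun _ => 1) (fun _ _ => le_rfl) ω
          · rw [Set.indicator_of_notMem fun h => hj h.2]
            exact zero_le
        · rw [Finset.sum_range_succ, Set.indicator_of_notMem fun h => hN h.1, add_zero]
          exact ih
    calc _ ≤ ∫⁻ _, ENNReal.ofReal M ∂μ := lintegral_mono_ae hle
      _ = _ := by simp
  have h3 : ENNReal.ofReal q * ∑' k, μ (E k) ≤ ENNReal.ofReal M := by
    rw [← ENNReal.tsum_mul_left]
    exact (ENNReal.tsum_le_tsum h).trans h2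
  rw [one_div_mul_eq_div, ENNReal.ofReal_div_of_pos hq]
  refine h1.trans ?_
  rwa [ENNReal.le_div_iff_mul_le (Or.inl (by simpa using hq)) (Or.inl ENNReal.ofReal_ne_top),
    mul_comm]

/-- Here `(1 - 1/r)² r = r - 2 + 1/r` and `r - 2 = γ(3 - γ²)/(1 - γ)`, so the claim reduces to `3γ²
- 4γ + 3 ≥ 0`. -/
lemma four_mul_sq_le_of_ratio {γ r : ℝ} (hγ1 : γ < 1) (hγ : 0 < γ)
    (hr : r = (2 + γ * (1 - γ ^ 2)) / (1 - γ)) : 2 < r ∧ 4 * γ ^ 2 ≤ (1 - 1 / r) ^ 2 * r := by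
  have h1 : 0 < 1 - γ := sub_pos.2 hγ1
  have h2 : r - 2 = γ * (3 - γ ^ 2) / (1 - γ) := by
    rw [hr]
    field_simp
    ring
  have h3 : 4 * γ ^ 2 ≤ r - 2 := by
    rw [h2, le_div_iff₀ h1]
    nlinarith [mul_nonneg hγ.le (sq_nonneg (3 * γ - 2))]
  have h4 : 2 < r := by
    have : 0 < 4 * γ ^ 2 := by positivity
    linarith
  refine ⟨h4, ?_⟩
  have h5 : (1 - 1 / r) ^ 2 * r = r - 2 + 1 / r := by
    have : r ≠ 0 := by linarith
    field_simp
    ring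
  have : 0 < 1 / r := by positivity
  linarith

/-- The tail bound for `K` that complements `lintegral_count_le`. -/
lemma measure_count_tail_le {𝓕 : Filtration ℕ mΩ} (hq : 1 / 2 ≤ q) (hq1 : q ≤ 1)
    (hE : ∀ k, MeasurableSet[𝓕 k] (E k)) (hT : ∀ k, MeasurableSet[𝓕 (k + 1)] (T k))
    (h : ∀ k R, MeasurableSet[𝓕 k] R → R ⊆ E k → ENNReal.ofReal q * μ R ≤ μ (R ∩ T k))
    (hK : ∀ᵐ ω ∂μ, ∀ N : ℕ, (N : ℕ∞) ≤ K ω ↔ ∀ j < N, ω ∈ E j)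
    (hM0 : 0 ≤ M)
    (hM : ∀ᵐ ω ∂μ, ∀ N : ℕ, (N : ℕ∞) ≤ K ω →
      ∑ j ∈ Finset.range N, (T j).indicator (fun _ => (1 : ℝ)) ω ≤ M) [IsProbabilityMeasure μ]
    {γ : ℝ} (hγ : 0 < γ) (hγ1 : γ < 1) :
    μ {ω | ENNReal.ofReal ((2 + γ * (1 - γ ^ 2)) / (1 - γ) * (1 / q) * M) ≤ (K ω : ℝ≥0∞)} ≤
      ENNReal.ofReal (Real.exp (-γ ^ 2 / q * M)) := by
  have hq0 : 0 < q := by linarith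
  set r := (2 + γ * (1 - γ ^ 2)) / (1 - γ) with hr
  obtain ⟨hr2, hγr⟩ := four_mul_sq_le_of_ratio hγ1 hγ hr
  have hr0 : 0 < r := by linarith
  set N := ⌈r * (1 / q) * M⌉₊ with hN
  have hNle : r * (1 / q) * M ≤ N := Nat.le_ceil _
  have hqN : r * M ≤ q * N := by
    calc r * M = q * (r * (1 / q) * M) := by field_simp
      _ ≤ q * N := by gcongr
  -- With `η = 1 - 1/r` the Chernoff threshold is `qN/r ≥ M`, so having at most `M` true iterations
  -- among the first `N` is the rare event.
  have hch := measure_sum_indicator_le_chernoff (N := N) hq0.le hq1 hE hT h (η := 1 - 1 / r)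
    (R := M) (by
      rw [sub_nonneg, div_le_one hr0]
      linarith) (by
      rw [sub_sub_cancel, mul_assoc, one_div_mul_eq_div, le_div_iff₀ hr0]
      linarith)
  refine le_trans (measure_mono_ae ?_) (hch.trans (ENNReal.ofReal_le_ofReal ?_))
  · filter_upwards [hK, hM] with ω hω hMω hle
    have hNK : (N : ℕ∞) ≤ K ω := by
      have hle' : ENNReal.ofReal (r * (1 / q) * M) ≤ (K ω : ℝ≥0∞) := hle
      generalize K ω = k at hle'
      induction k with
      | top => exact le_top
      | coe k =>
        rw [ENat.toENNReal_coe, ENNReal.ofReal_le_natCast] at hle'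
        exact_mod_cast Nat.ceil_le.2 hle'
    exact ⟨(hω N).1 hNK, hMω N hNK⟩
  · rw [Real.exp_le_exp]
    have h1 : (1 - 1 / r) ^ 2 * (r * M) ≤ (1 - 1 / r) ^ 2 * (q * N) := by gcongr
    -- This is where `q ≥ 1/2`, that is `δ ≤ 1/2`, is needed.
    have h2 : γ ^ 2 / q * M ≤ 2 * γ ^ 2 * M := by
      refine mul_le_mul_of_nonneg_right ?_ hM0
      rw [div_le_iff₀ hq0]
      nlinarith [sq_nonneg γ]
    have h3 := mul_le_mul_of_nonneg_right hγr hM0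
    rw [neg_div]
    linarith

end Counting

/-! ### Runs of the stochastic Newton method -/

/-- The event that iteration `k` is executed and the iterates up to `k` lie in `U`. -/
def activeSet {n : ℕ} {Ω : Type*} (U : Set (EucSp n)) (G : EucSp n → EucSp n) (ε : ℝ)
    (X : ℕ → Ω → EucSp n) (k : ℕ) : Set Ω :=
  {ω | ∀ i ≤ k, X i ω ∈ U ∧ ε ≤ ‖G (X i ω)‖}

/-- The event that the matrix sampled in iteration `k` lies in the Newton differential. -/
def trueSet {n : ℕ} {Ω : Type*} (U : Set (EucSp n)) (Hf : EucSp n → Set (SqMat n))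
    (X : ℕ → Ω → EucSp n) (A : ℕ → Ω → SqMat n) (k : ℕ) : Set Ω :=
  {ω | (X k ω, A k ω) ∈ {p : EucSp n × SqMat n | p.1 ∈ U ∧ p.2 ∈ Hf p.1}}

lemma natCast_le_iterCount_iff {n : ℕ} {Ω : Type*} {G : EucSp n → EucSp n} {ε : ℝ}
    {X : ℕ → Ω → EucSp n} {ω : Ω} {N : ℕ} :
    (N : ℕ∞) ≤ iterCount G ε X ω ↔ ∀ j < N, ε ≤ ‖G (X j ω)‖ := by
  rw [iterCount, le_iInf₂_iff]
  refine forall_congr' fun j => ?_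
  rw [Nat.cast_le, ← not_lt, ← not_lt]
  tauto

lemma natCast_lt_iterCount_iff {n : ℕ} {Ω : Type*} {G : EucSp n → EucSp n} {ε : ℝ}
    {X : ℕ → Ω → EucSp n} {ω : Ω} {N : ℕ} :
    (N : ℕ∞) < iterCount G ε X ω ↔ ∀ j ≤ N, ε ≤ ‖G (X j ω)‖ := by
  rw [← ENat.add_one_le_iff (ENat.natCast_ne_top N)]
  have := natCast_le_iterCount_iff (G := G) (ε := ε) (X := X) (ω := ω) (N := N + 1)
  push_cast at this
  simpa [Nat.lt_succ_iff] using this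

/-- A set hit with positive probability is nonempty; this supplies the hypothesis of the growth
bound. -/
lemma IsHessianOracle.nonempty {n : ℕ} {U : Set (EucSp n)} {Hf : EucSp n → Set (SqMat n)} {δ : ℝ}
    {Ξ : Type*} [MeasurableSpace Ξ] {ν : Measure Ξ} {Hrand : EucSp n → Ξ → SqMat n}
    (h : IsHessianOracle U Hf δ ν Hrand) (hδ : δ < 1) : ∀ z ∈ U, (Hf z).Nonempty := by
  intro z hz
  by_contra hne
  have h1 := h.prob z hz
  simp only [Set.not_nonempty_iff_eq_empty.1 hne, Set.mem_empty_iff_false] at h1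
  have h2 : ENNReal.ofReal (1 - δ) ≤ 0 := by simpa using h1
  rw [nonpos_iff_eq_zero, ENNReal.ofReal_eq_zero] at h2
  linarith

namespace IsStochNewtonRun

variable {n : ℕ} {f : EucSp n → ℝ} {U : Set (EucSp n)} {xbar : EucSp n}
    {G : EucSp n → EucSp n} {Hf : EucSp n → Set (SqMat n)} {x₀ : EucSp n} {c₀ α ε δ : ℝ}
    {Ξ : Type*} [MeasurableSpace Ξ] {ν : Measure Ξ} {Hrand : EucSp n → Ξ → SqMat n}
    {Ω : Type*} {mΩ : MeasurableSpace Ω} {μ : Measure Ω} {𝓕 : Filtration ℕ mΩ}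
    {X : ℕ → Ω → EucSp n} {A : ℕ → Ω → SqMat n} {C : ℕ → Ω → ℝ}

/-- `G` is arbitrary outside `U`, so measurability comes from its continuity on the open set `U`. -/
lemma measurableSet_activeSet (h : IsStochNewtonRun f U G Hf x₀ c₀ α ε ν Hrand μ 𝓕 X A C)
    (hU : IsOpen U) (hG : ContinuousOn G U) (k : ℕ) :
    MeasurableSet[𝓕 k] (activeSet U G ε X k) := by
  have hS : MeasurableSet {x | x ∈ U ∧ ε ≤ ‖G x‖} := by
    have h1 : {x | x ∈ U ∧ ε ≤ ‖G x‖} = U \ (U ∩ (fun x => ‖G x‖) ⁻¹' Set.Iio ε) := by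
      ext x
      simp only [Set.mem_ofPred_eq, Set.mem_sdiff, Set.mem_inter_iff, Set.mem_preimage, Set.mem_Iio,
        ← not_lt]
      tauto
    rw [h1]
    exact hU.measurableSet.diff (hG.norm.isOpen_inter_preimage hU isOpen_Iio).measurableSet
  have h2 : activeSet U G ε X k = ⋂ i ∈ Set.Iic k, X i ⁻¹' {x | x ∈ U ∧ ε ≤ ‖G x‖} := by
    ext ω
    simp [activeSet]
  rw [h2]
  refine MeasurableSet.biInter (Set.to_countable _) fun i hi => ?_
  exact 𝓕.mono hi _ (h.adapted i hS)

lemma measurableSet_trueSet (h : IsStochNewtonRun f U G Hf x₀ c₀ α ε ν Hrand μ 𝓕 X A C)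
    (hmeas : MeasurableSet {p : EucSp n × SqMat n | p.1 ∈ U ∧ p.2 ∈ Hf p.1}) (k : ℕ) :
    MeasurableSet[𝓕 (k + 1)] (trueSet U Hf X A k) :=
  (((h.adapted k).mono (𝓕.mono k.le_succ) le_rfl).prodMk (h.sample_measurable k)) hmeas

lemma mul_measure_le [IsProbabilityMeasure ν] [IsProbabilityMeasure μ]
    (h : IsStochNewtonRun f U G Hf x₀ c₀ α ε ν Hrand μ 𝓕 X A C)
    (ho : IsHessianOracle U Hf δ ν Hrand)
    (hmeas : MeasurableSet {p : EucSp n × SqMat n | p.1 ∈ U ∧ p.2 ∈ Hf p.1}) (k : ℕ) (R : Set Ω)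
    (hR : MeasurableSet[𝓕 k] R) (hRE : R ⊆ activeSet U G ε X k) :
    ENNReal.ofReal (1 - δ) * μ R ≤ μ (R ∩ trueSet U Hf X A k) := by
  refine mul_measure_le_measure_inter (𝓕.le k) (h.adapted k)
    ((h.sample_measurable k).mono (𝓕.le _) le_rfl)
    (randomFunctionKernel ν Hrand ho.measurable) hR ?_ hmeas ?_
  · intro S hS
    filter_upwards [h.sample_law k S hS] with ω hω hωR
    rw [hω (natCast_lt_iterCount_iff.2 fun j hj => (hRE hωR j hj).2), measureReal_def,
      measureReal_def, randomFunctionKernel_apply _ _ _ _ hS]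
  · intro ω hω
    have hXU : X k ω ∈ U := (hRE hω k le_rfl).1
    rw [randomFunctionKernel_apply _ _ _ _ (measurable_prodMk_left hmeas)]
    refine (ho.prob _ hXU).trans (measure_mono fun ξ hξ => ?_)
    exact ⟨hXU, hξ⟩

lemma ae_natCast_le_iterCount_iff
    (h : IsStochNewtonRun f U G Hf x₀ c₀ α ε ν Hrand μ 𝓕 X A C) :
    ∀ᵐ ω ∂μ, ∀ N : ℕ, (N : ℕ∞) ≤ iterCount G ε X ω ↔ ∀ j < N, ω ∈ activeSet U G ε X j := by
  filter_upwards [ae_all_iff.2 h.stays] with ω hω N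
  refine ⟨fun hN j hj i hi => ⟨hω i (le_trans ?_ hN), ?_⟩, fun hN => ?_⟩
  · exact_mod_cast (hi.trans_lt hj).le
  · exact natCast_le_iterCount_iff.1 hN i (hi.trans_lt hj)
  · exact natCast_le_iterCount_iff.2 fun j hj => (hN j hj j le_rfl).2

/-- Almost surely, the number of true iterations is controlled by the decrease of the objective. -/
lemma ae_sum_indicator_trueSet_le
    (h : IsStochNewtonRun f U G Hf x₀ c₀ α ε ν Hrand μ 𝓕 X A C) {ρ τ κ : ℝ}
    (hρ : 0 < ρ) (hτ : 0 < τ) (hκ : 0 < κ) (hc₀ : 0 < c₀) (hα : 0 < α) (hα1 : α < 1)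
    (hdec : ∀ x ∈ U, ∀ H ∈ Hf x, trialPoint G H x ∈ U →
      ρ * ‖trialPoint G H x - x‖ ^ 2 ≤ f x - f (trialPoint G H x) ∧
      ρ * ‖G x‖ ≤ ‖trialPoint G H x - x‖ ∧ τ * ‖G x‖ ≤ ‖trialPoint G H x - x‖)
    (hgrow : ∀ x ∈ U, κ * ‖G x‖ ^ 2 ≤ f x - f xbar) :
    ∀ᵐ ω ∂μ, ∀ N : ℕ, (N : ℕ∞) ≤ iterCount G ε X ω → ∀ g : ℝ, 0 ≤ g →
      (∀ k < N, g ≤ ‖G (X k ω)‖) →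
      min κ (ρ * τ ^ 2) / 2 *
        (∑ k ∈ Finset.range N, (trueSet U Hf X A k).indicator (fun _ => (1 : ℝ)) ω -
          Real.log (min ρ c₀ / c₀) / Real.log α) * g ^ 2 ≤ f x₀ - f xbar := by
  filter_upwards [h.init, ae_all_iff.2 h.success, ae_all_iff.2 h.failure, ae_all_iff.2 h.stays,
    ae_all_iff.2 h.stays_trial] with ω hi hs hf hst htr N hN g hg hgN
  have hlt : ∀ k < N, (k : ℕ∞) < iterCount G ε X ω := fun k hk =>
    lt_of_lt_of_le (by exact_mod_cast hk) hN
  exact sum_indicator_true_le (x := fun k => X k ω) (A := fun k => A k ω) (c := fun k => C k ω)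
    (s := {k | ω ∈ trueSet U Hf X A k}) hρ hτ hκ hc₀ hα hα1 hg hdec hgrow hi.1 hi.2
    (fun k hk => hs k (hlt k hk)) (fun k hk => hf k (hlt k hk))
    (fun k hk => hst k (le_trans (by exact_mod_cast hk) hN)) (fun k hk => htr k (hlt k hk))
    hgN (fun k _ hk => hk.2)

end IsStochNewtonRun

/-! ### Elementary inequalities for the iteration bounds -/

lemma le_div_add_of_mul_sub_mul_sq_le {m ρ₀ c₀ ε D S L : ℝ} (hm : 0 < m) (hρ₀ : 0 < ρ₀)
    (hc₀ : 0 < c₀) (hε : 0 < ε) (hD : 0 ≤ D) (h : m * (S - L) * ε ^ 2 ≤ D) :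
    S ≤ D / (min ρ₀ c₀ * (√(m / ρ₀) * ε) ^ 2) + L := by
  have hρ : 0 < min ρ₀ c₀ := lt_min hρ₀ hc₀
  have h1 : min ρ₀ c₀ * (√(m / ρ₀) * ε) ^ 2 ≤ m * ε ^ 2 := by
    rw [mul_pow, Real.sq_sqrt (by positivity)]
    calc min ρ₀ c₀ * (m / ρ₀ * ε ^ 2) ≤ ρ₀ * (m / ρ₀ * ε ^ 2) := by
          gcongr
          exact min_le_left _ _
      _ = m * ε ^ 2 := by field_simp
  have h2 : S - L ≤ D / (m * ε ^ 2) := by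
    rw [le_div_iff₀ (by positivity)]
    linarith
  have h3 : D / (m * ε ^ 2) ≤ D / (min ρ₀ c₀ * (√(m / ρ₀) * ε) ^ 2) := by gcongr
  linarith

lemma sum_le_of_sqrt_le {m q ρ τ D S L P g : ℝ} (hm : 0 < m) (hq : 0 < q)
    (hρτ : ρ * τ ^ 2 = m * q) (hD : 0 < D) (hP : 0 < P) (hg : √(D / (ρ * τ ^ 2 * P)) ≤ g)
    (h : m * (S - L) * g ^ 2 ≤ D) : S ≤ q * P + L := by
  rw [hρτ] at hg
  have h1 : 0 < D / (m * q * P) := by positivity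
  have hg0 : 0 < g := (Real.sqrt_pos.2 h1).trans_le hg
  have h2 : D ≤ m * q * P * g ^ 2 := by
    have := (Real.sqrt_le_left hg0.le).1 hg
    rwa [div_le_iff₀ (by positivity), mul_comm] at this
  have h3 : m * g ^ 2 * (S - L) ≤ m * g ^ 2 * (q * P) := by linarith
  have := le_of_mul_le_mul_left h3 (by positivity)
  linarith

theorem mainTheorem1 {n : ℕ} (f : EucSp n → ℝ) (U : Set (EucSp n)) (xbar : EucSp n)
    (G : EucSp n → EucSp n) (Hf : EucSp n → Set (SqMat n))
    (hreg : RegularityAssumption f U xbar G Hf)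
    (hmeas : MeasurableSet {p : EucSp n × SqMat n | p.1 ∈ U ∧ p.2 ∈ Hf p.1}) :
    -- Part 1: `ρ₀` and `τ` depend on `f`, `U` and `Hf` only, and `ρ = min ρ₀ c₀`
    (∃ ρ₀ > 0, ∃ τ > 0, ∀ (c₀ α ε δ : ℝ), 0 < c₀ → 0 < α → α < 1 → 0 < ε → ε < 1 →
      0 ≤ δ → δ < 1 → ∀ x₀ ∈ U,
      ∀ (Ξ : Type u) [MeasurableSpace Ξ] (ν : Measure Ξ) [IsProbabilityMeasure ν]
        (Hrand : EucSp n → Ξ → SqMat n), IsHessianOracle U Hf δ ν Hrand →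
      ∀ (Ω : Type v) (mΩ : MeasurableSpace Ω) (μ : Measure Ω) [IsProbabilityMeasure μ]
        (𝓕 : Filtration ℕ mΩ) (X : ℕ → Ω → EucSp n) (A : ℕ → Ω → SqMat n) (C : ℕ → Ω → ℝ),
      IsStochNewtonRun f U G Hf x₀ c₀ α ε ν Hrand μ 𝓕 X A C →
        ∫⁻ ω, (iterCount G ε X ω : ℝ≥0∞) ∂μ ≤
          ENNReal.ofReal (1 / (1 - δ) * iterBound f x₀ xbar (min ρ₀ c₀) τ ε c₀ α) ∧
        (δ ≤ 1 / 2 → ∀ γ : ℝ, 0 < γ → γ < 1 →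
          μ {ω | ENNReal.ofReal ((2 + γ * (1 - γ ^ 2)) / (1 - γ) * (1 / (1 - δ)) *
              iterBound f x₀ xbar (min ρ₀ c₀) τ ε c₀ α) ≤ (iterCount G ε X ω : ℝ≥0∞)} ≤
            ENNReal.ofReal (Real.exp
              (-γ ^ 2 / (1 - δ) * iterBound f x₀ xbar (min ρ₀ c₀) τ ε c₀ α)))) ∧
    -- Part 2: `ρ` and `τ` depend on `f`, `U`, `Hf`, `c₀` and `δ` only, and `K` is a fixed number
    (∀ (c₀ δ : ℝ), 0 < c₀ → 0 ≤ δ → δ < 1 → ∃ ρ > 0, ∃ τ > 0,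
      ∀ (α ε : ℝ), 0 < α → α < 1 → 0 ≤ ε → ε < 1 → ∀ x₀ ∈ U, x₀ ≠ xbar →
      ∀ (Ξ : Type u) [MeasurableSpace Ξ] (ν : Measure Ξ) [IsProbabilityMeasure ν]
        (Hrand : EucSp n → Ξ → SqMat n), IsHessianOracle U Hf δ ν Hrand →
      ∀ (Ω : Type v) (mΩ : MeasurableSpace Ω) (μ : Measure Ω) [IsProbabilityMeasure μ]
        (𝓕 : Filtration ℕ mΩ) (X : ℕ → Ω → EucSp n) (A : ℕ → Ω → SqMat n) (C : ℕ → Ω → ℝ),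
      IsStochNewtonRun f U G Hf x₀ c₀ α ε ν Hrand μ 𝓕 X A C →
      ∀ (γ : ℝ) (K : ℕ), 0 < γ → γ < 1 →
        Real.log (ρ / c₀) / Real.log α < (1 - γ) * K →
        μ {ω | (K : ℕ∞) ≤ iterCount G ε X ω ∧
            √((f x₀ - f xbar) /
                (ρ * τ ^ 2 * ((1 - γ) * K - Real.log (ρ / c₀) / Real.log α))) ≤
              (Finset.range (K + 1)).inf' Finset.nonempty_range_add_one
                (fun k => ‖G (X k ω)‖)} ≤
          ENNReal.ofReal (Real.exp (-K * (1 - δ) * γ ^ 2 / 2))) := by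

  obtain ⟨ρ₀, hρ₀, τ₀, hτ₀, κ, hκ, hdec, hgrow⟩ := hreg.exists_constants
  have hm : 0 < min κ (ρ₀ * τ₀ ^ 2) / 2 := half_pos (lt_min hκ (by positivity))
  set m := min κ (ρ₀ * τ₀ ^ 2) / 2 with hmdef
  constructor
  -- Dividing by `ρ₀` rather than `min ρ₀ c₀` keeps `τ` independent of `c₀`, and still `min ρ₀ c₀ *
  -- τ² ≤ m`.
  · refine ⟨ρ₀, hρ₀, √(m / ρ₀), Real.sqrt_pos.2 (by positivity), ?_⟩
    intro c₀ α ε δ hc₀ hα hα1 hε hε1 hδ hδ1 x₀ hx₀ Ξ _ ν _ Hrand ho Ω mΩ μ _ 𝓕 X A C hrun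
    obtain ⟨hcont, hgr⟩ := hgrow (ho.nonempty hδ1)
    have hE := hrun.measurableSet_activeSet hreg.isOpen hcont
    have hT := hrun.measurableSet_trueSet hmeas
    have hET := hrun.mul_measure_le ho hmeas
    have hK := hrun.ae_natCast_le_iterCount_iff
    have hD : 0 ≤ f x₀ - f xbar := le_trans (by positivity) (hgr x₀ hx₀).1
    have hM : ∀ᵐ ω ∂μ, ∀ N : ℕ, (N : ℕ∞) ≤ iterCount G ε X ω →
        ∑ j ∈ Finset.range N, (trueSet U Hf X A j).indicator (fun _ => (1 : ℝ)) ω ≤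
          iterBound f x₀ xbar (min ρ₀ c₀) (√(m / ρ₀)) ε c₀ α := by
      filter_upwards [hrun.ae_sum_indicator_trueSet_le hρ₀ hτ₀ hκ hc₀ hα hα1 hdec
        fun x hx => (hgr x hx).1] with ω hω N hN
      exact le_div_add_of_mul_sub_mul_sq_le hm hρ₀ hc₀ hε hD
        (hω N hN ε hε.le (natCast_le_iterCount_iff.1 hN))
    have hM0 : 0 ≤ iterBound f x₀ xbar (min ρ₀ c₀) (√(m / ρ₀)) ε c₀ α := by
      have hρ : 0 < min ρ₀ c₀ := lt_min hρ₀ hc₀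
      exact add_nonneg (by positivity)
        (log_div_div_log_nonneg hρ (min_le_right _ _) hα hα1)
    refine ⟨lintegral_count_le (sub_pos.2 hδ1) (fun k => 𝓕.le _ _ (hE k))
      (fun k => 𝓕.le _ _ (hT k)) (fun k => hET k _ (hE k) le_rfl) hK
      (fun ω k hk j hj i hi => hk i (hi.trans hj)) hM, fun hδ2 γ hγ hγ1 => ?_⟩
    exact measure_count_tail_le (by linarith) (by linarith) hE hT hET hK hM0 hM hγ hγ1
  · intro c₀ δ hc₀ hδ hδ1
    have hq : 0 < 1 - δ := sub_pos.2 hδ1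
    have hρ₁ : 0 < min ρ₀ c₀ := lt_min hρ₀ hc₀
    have hρ : 0 < c₀ * (min ρ₀ c₀ / c₀) ^ (1 / (1 - δ)) := by positivity
    -- The power multiplies the backtracking term `L` by `1/(1 - δ)`, and the choice of `τ` gives `ρ
    -- τ² = m(1 - δ)`. On the bad event the number of true iterations is then at most `(1 - δ)((1 -
    -- γ)K - L/(1 - δ)) + L = (1 - γ)(1 - δ)K`, exactly the Chernoff threshold for `η = γ`.
    set ρ := c₀ * (min ρ₀ c₀ / c₀) ^ (1 / (1 - δ)) with hρdef
    have hlog : Real.log (ρ / c₀) = 1 / (1 - δ) * Real.log (min ρ₀ c₀ / c₀) := by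
      rw [hρdef, mul_div_cancel_left₀ _ hc₀.ne', Real.log_rpow (by positivity)]
    refine ⟨ρ, hρ, √(m * (1 - δ) / ρ), Real.sqrt_pos.2 (by positivity), ?_⟩
    intro α ε hα hα1 hε hε1 x₀ hx₀ hxne Ξ _ ν _ Hrand ho Ω mΩ μ _ 𝓕 X A C hrun γ K hγ hγ1 hKγ
    obtain ⟨hcont, hgr⟩ := hgrow (ho.nonempty hδ1)
    have hch := measure_sum_indicator_le_chernoff (μ := μ) (N := K) hq.le (by linarith)
      (hrun.measurableSet_activeSet hreg.isOpen hcont) (hrun.measurableSet_trueSet hmeas)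
      (hrun.mul_measure_le ho hmeas) (η := γ) (R := (1 - γ) * (1 - δ) * K) hγ.le le_rfl
    refine le_trans (measure_mono_ae ?_) (hch.trans_eq ?_)
    · filter_upwards [hrun.ae_natCast_le_iterCount_iff,
        hrun.ae_sum_indicator_trueSet_le hρ₀ hτ₀ hκ hc₀ hα hα1 hdec fun x hx => (hgr x hx).1]
        with ω hω hωS hbad
      obtain ⟨hKω, hmin⟩ := hbad
      refine ⟨(hω K).1 hKω, ?_⟩
      have hρτ : ρ * √(m * (1 - δ) / ρ) ^ 2 = m * (1 - δ) := by
        rw [Real.sq_sqrt (by positivity), mul_div_cancel₀ _ hρ.ne']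
      have hS := hωS K hKω _ (le_trans (Real.sqrt_nonneg _) hmin) fun k hk =>
        Finset.inf'_le _ (Finset.mem_range.2 (by omega))
      refine (sum_le_of_sqrt_le hm hq hρτ ((hgr x₀ hx₀).2 hxne) (sub_pos.2 hKγ) hmin hS).trans ?_
      rw [hlog]
      apply le_of_eq
      have hq' := hq.ne'
      field_simp
      ring
    · congr 2
      ring
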